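/- Let $R$ be a commutative ring with $R=2R$ (that is, $2$ is invertible) and let $I$ be an ideal of $R$. Let $(P,\langle\,,\rangle)$ be a symplectic $R$-module: $P$ is a finitely generated projective $R$-module of constant rank $2n$, $n\ge 1$, and $\langle\,,\rangle$ is an alternating bilinear form on $P$ such that $x\mapsto\langle x,\cdot\rangle$ is an isomorphism $P\cong P^*$. Assume that for each maximal ideal $\mathfrak m$ of $R$ the form is given, in some basis of $P_{\mathfrak m}$, by a matrix $\varphi_{\mathfrak m}$ over $R_{\mathfrak m}$ with $\varphi_{\mathfrak m}\equiv\psi_n \pmod{I_{\mathfrak m}}$, where $\psi_n=\sum_{i=1}^n e_{2i-1,2i}-\sum_{i=1}^n e_{2i,2i-1}$. Let $Q=\mathbb H(R)\perp P=R^2\oplus P$ with the form $\langle(a_1,b_1,p_1),(a_2,b_2,p_2)\rangle=a_1b_2-a_2b_1+\langle p_1,p_2\rangle$. Let ${\rm Um}(Q,IQ)$ be the set of $v\in Q$ such that for every maximal ideal $\mathfrak m$ the image $v_{\mathfrak m}$ is unimodular in the free module $Q_{\mathfrak m}$ and $v_{\mathfrak m}\equiv(1,0,0)\pmod{I_{\mathfrak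 m}Q_{\mathfrak m}}$. *Linear transvections.* Write $Q=R\perp M$ with $M=R\oplus P$. Let ${\rm ETrans}(Q)$ be the group of automorphisms of $Q$ generated by all $(a,y)\mapsto(a,y+ax)$ with $x\in M$ and all $(a,y)\mapsto(a+\tau(y),y)$ with $\tau\in M^*$. Let ${\rm ETrans}(IQ)$ be the subgroup generated by those with $x\in IM$, respectively $\tau\in IM^*$, and let ${\rm ETrans}(Q,IQ)$ be the normal closure of ${\rm ETrans}(IQ)$ in ${\rm ETrans}(Q)$. *Symplectic transvections.* Let ${\rm ETrans}_{\rm Sp}(Q,\langle\,,\rangle)$ be the group generated by the isometries of $Q$ $$(a,b,p)\mapsto(a,\;b+\langle p,q\rangle+\alpha a,\;p+aq),\qquad (a,b,p)\mapsto(a-\langle p,q\rangle-\beta b,\;b,\;p+bq)$$ with $q\in P$ and $\alpha,\beta\in R$. Let ${\rm ETrans}_{\rm Sp}(IQ,\langle\,,\rangle)$ be the subgroup generated by those with $q\in IP$ and $\alpha,\beta\in I$, and let ${\rm ETrans}_{\rm Sp}(Q,IQ,\langle\,,\rangle)$ be the normal closure of ${\rm ETrans}_{\rm Sp}(IQ,\langle\,,\rangle)$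 in ${\rm ETrans}_{\rm Sp}(Q,\langle\,,\rangle)$. Then for every $v=(a,b,p)\in{\rm Um}(Q,IQ)$ the orbits of $v$ under the two relative groups coincide: $$(a,b,p)\,{\rm ETrans}(Q,IQ)=(a,b,p)\,{\rm ETrans}_{\rm Sp}(Q,IQ,\langle\,,\rangle).$$ -/

import Mathlib

open scoped TensorProduct

namespace TransvectionOrbits

section Unimodular

variable {R : Type*} [CommRing R] {M : Type*} [AddCommGroup M] [Module R M]

/-- `v` is unimodular: at every maximal ideal `m`, the image of `v` in `M_m = R_m ⊗ M` is a
unimodular vector, i.e. some `R_m`-linear functional (for `M_m` free: a row `w` with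
`∑ wᵢ vᵢ = 1`) takes the value `1` on it. -/
def IsUnimodular (R : Type*) [CommRing R] {M : Type*} [AddCommGroup M] [Module R M]
    (v : M) : Prop :=
  ∀ (m : Ideal R) [m.IsMaximal],
    ∃ w : Module.Dual (Localization.AtPrime m) (Localization.AtPrime m ⊗[R] M),
      w (1 ⊗ₜ[R] v) = 1

/-- The set `Um(M, IM)` with respect to a base vector `e` of `M`: the unimodular elements `v`
with `v_m ≡ e_m` modulo `I_m M_m` at every maximal ideal `m`. -/
def UmRel (I : Ideal R) (e : M) : Set M :=
  {v | IsUnimodular R v ∧ ∀ (m : Ideal R) [m.IsMaximal],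
    ((1 : Localization.AtPrime m) ⊗ₜ[R] v - (1 : Localization.AtPrime m) ⊗ₜ[R] e) ∈
      (I.map (algebraMap R (Localization.AtPrime m)) •
        (⊤ : Submodule (Localization.AtPrime m) (Localization.AtPrime m ⊗[R] M)))}

end Unimodular

/-- For subgroups `H ≤ G` of an ambient group, the normal closure of `H` in `G`, as a subgroup of
the ambient group. -/
def relNormalClosure {A : Type*} [Group A] (G H : Subgroup A) : Subgroup A :=
  (Subgroup.normalClosure ((H.subgroupOf G : Subgroup G) : Set G)).map G.subtype

section Linear

variable {R : Type*} [CommRing R] {M : Type*} [AddCommGroup M] [Module R M]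

/-- The elementary transvection `(a, p) ↦ (a, p + a x)` of `R ⊥ M`. -/
def linE (x : M) : (R × M) ≃ₗ[R] (R × M) where
  toFun z := (z.1, z.2 + z.1 • x)
  invFun z := (z.1, z.2 - z.1 • x)
  map_add' y z := by ext <;> simp [add_smul]; abel
  map_smul' c z := by ext <;> simp [mul_smul]
  left_inv z := by simp
  right_inv z := by simp

/-- The elementary transvection `(a, p) ↦ (a + τ(p), p)` of `R ⊥ M`. -/
def linEStar (τ : Module.Dual R M) : (R × M) ≃ₗ[R] (R × M) where
  toFun z := (z.1 + τ z.2, z.2)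
  invFun z := (z.1 - τ z.2, z.2)
  map_add' y z := by ext <;> simp; ring
  map_smul' c z := by ext <;> simp; ring
  left_inv z := by simp
  right_inv z := by simp

variable (R M) in
/-- `ETrans(N)` for `N = R ⊥ M`. -/
def ETrans : Subgroup ((R × M) ≃ₗ[R] (R × M)) :=
  Subgroup.closure (Set.range (linE (R := R) (M := M)) ∪ Set.range (linEStar (R := R) (M := M)))

variable (M) in
/-- `ETrans(IN)` for `N = R ⊥ M`: generated by the `E_x`, `E*_τ` with `x ∈ IM`, `τ ∈ IM*`. -/
def ETransIdeal (I : Ideal R) : Subgroup ((R × M) ≃ₗ[R] (R × M)) :=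
  Subgroup.closure
    (linE '' ((I • (⊤ : Submodule R M) : Submodule R M) : Set M) ∪
      linEStar '' ((I • (⊤ : Submodule R (Module.Dual R M)) : Submodule R (Module.Dual R M)) :
        Set (Module.Dual R M)))

variable (M) in
/-- `ETrans(N, IN)` for `N = R ⊥ M`. -/
def ETransRel (I : Ideal R) : Subgroup ((R × M) ≃ₗ[R] (R × M)) :=
  relNormalClosure (ETrans R M) (ETransIdeal M I)

end Linear

section Symplectic

variable {R : Type*} [CommRing R] {P : Type*} [AddCommGroup P] [Module R P]

variable (R P) in
/-- A non-degenerate alternating bilinear form: `x ↦ ⟨x, ·⟩` is an isomorphism `P ≅ P*`. -/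
structure SymplecticForm where
  form : LinearMap.BilinForm R P
  alt : form.IsAlt
  nondeg : Function.Bijective (fun x : P => (form x : Module.Dual R P))

/-- The alternating form `⟨(a₁, b₁, p₁), (a₂, b₂, p₂)⟩ = a₁ b₂ - a₂ b₁ + ⟨p₁, p₂⟩` of
`Q = ℍ(R) ⊥ P`, with `ℍ(R) = R ⊕ R* = R²`. -/
def formQ (B : LinearMap.BilinForm R P) : LinearMap.BilinForm R (R × R × P) :=
  LinearMap.mk₂ R (fun y z => y.1 * z.2.1 - z.1 * y.2.1 + B y.2.2 z.2.2)
    (fun x y z => by simp; ring) (fun c y z => by simp; ring)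
    (fun x y z => by simp; ring) (fun c y z => by simp; ring)

@[simp] theorem formQ_apply (B : LinearMap.BilinForm R P) (y z : R × R × P) :
    formQ B y z = y.1 * z.2.1 - z.1 * y.2.1 + B y.2.2 z.2.2 := rfl

/-- The symplectic transvection `p ↦ p + ⟨u,p⟩ v + ⟨v,p⟩ u + α ⟨u,p⟩ u` (an isometry when
`⟨u,v⟩ = 0`, for an alternating form). -/
def sympTransvection (B : LinearMap.BilinForm R P) (u v : P) (α : R) (p : P) : P :=
  p + B u p • v + B v p • u + (α * B u p) • u

/-- The elementary symplectic transvection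
`(a, b, p) ↦ (a, b + ⟨p,q⟩ + α a, p + a q)` of `Q = R² ⊥ P`. -/
def sympRho (ω : SymplecticForm R P) (q : P) (α : R) : (R × R × P) ≃ₗ[R] (R × R × P) where
  toFun z := (z.1, z.2.1 + ω.form z.2.2 q + α * z.1, z.2.2 + z.1 • q)
  invFun z := (z.1, z.2.1 - ω.form z.2.2 q - α * z.1, z.2.2 - z.1 • q)
  map_add' y z := by
    ext
    · simp
    · simp; ring
    · simp [add_smul]; abel
  map_smul' c z := by
    ext
    · simp
    · simp; ring
    · simp [mul_smul]
  left_inv z := by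
    have h := ω.alt q
    ext <;> simp [h]
    ring
  right_inv z := by
    have h := ω.alt q
    ext <;> simp [h]
    ring

/-- The elementary symplectic transvection
`(a, b, p) ↦ (a - ⟨p,q⟩ - β b, b, p + b q)` of `Q = R² ⊥ P`. -/
def sympMu (ω : SymplecticForm R P) (q : P) (β : R) : (R × R × P) ≃ₗ[R] (R × R × P) where
  toFun z := (z.1 - ω.form z.2.2 q - β * z.2.1, z.2.1, z.2.2 + z.2.1 • q)
  invFun z := (z.1 + ω.form z.2.2 q + β * z.2.1, z.2.1, z.2.2 - z.2.1 • q)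
  map_add' y z := by
    ext
    · simp; ring
    · simp
    · simp [add_smul]; abel
  map_smul' c z := by
    ext
    · simp; ring
    · simp
    · simp [mul_smul]
  left_inv z := by
    have h := ω.alt q
    ext <;> simp [h]
    ring
  right_inv z := by
    have h := ω.alt q
    ext <;> simp [h]
    ring

/-- `sympRho` is the symplectic transvection of `Q` with `u = (0, 1, 0)`, `v = (0, 0, -q)`. -/
theorem sympRho_eq (ω : SymplecticForm R P) (q : P) (α : R) (z : R × R × P) :
    sympRho ω q α z = sympTransvection (formQ ω.form) (0, 1, 0) (0, 0, -q) (-α) z := by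
  have h : ω.form q z.2.2 = -ω.form z.2.2 q := (ω.alt.neg_eq z.2.2 q).symm
  ext <;> simp [sympRho, sympTransvection, h]

/-- `sympMu` is the symplectic transvection of `Q` with `u = (-1, 0, 0)`, `v = (0, 0, -q)`. -/
theorem sympMu_eq (ω : SymplecticForm R P) (q : P) (β : R) (z : R × R × P) :
    sympMu ω q β z = sympTransvection (formQ ω.form) (-1, 0, 0) (0, 0, -q) (-β) z := by
  have h : ω.form q z.2.2 = -ω.form z.2.2 q := (ω.alt.neg_eq z.2.2 q).symm
  ext <;> simp [sympMu, sympTransvection, h]; ring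

theorem sympRho_isometry (ω : SymplecticForm R P) (q : P) (α : R) (y z : R × R × P) :
    formQ ω.form (sympRho ω q α y) (sympRho ω q α z) = formQ ω.form y z := by
  have h : ω.form q z.2.2 = -ω.form z.2.2 q := (ω.alt.neg_eq z.2.2 q).symm
  have h' := ω.alt q
  simp [sympRho, h, h']; ring

theorem sympMu_isometry (ω : SymplecticForm R P) (q : P) (β : R) (y z : R × R × P) :
    formQ ω.form (sympMu ω q β y) (sympMu ω q β z) = formQ ω.form y z := by
  have h : ω.form q z.2.2 = -ω.form z.2.2 q := (ω.alt.neg_eq z.2.2 q).symm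
  have h' := ω.alt q
  simp [sympMu, h, h']; ring

/-- `ETrans_Sp(Q)`. -/
def ETransSp (ω : SymplecticForm R P) : Subgroup ((R × R × P) ≃ₗ[R] (R × R × P)) :=
  Subgroup.closure
    ({g | ∃ (q : P) (α : R), g = sympRho ω q α} ∪ {g | ∃ (q : P) (β : R), g = sympMu ω q β})

/-- `ETrans_Sp(IQ)`: the parameters are `q ∈ IP` and `α, β ∈ I`. -/
def ETransSpIdeal (ω : SymplecticForm R P) (I : Ideal R) :
    Subgroup ((R × R × P) ≃ₗ[R] (R × R × P)) :=
  Subgroup.closure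
    ({g | ∃ q ∈ (I • ⊤ : Submodule R P), ∃ α ∈ I, g = sympRho ω q α} ∪
      {g | ∃ q ∈ (I • ⊤ : Submodule R P), ∃ β ∈ I, g = sympMu ω q β})

/-- `ETrans_Sp(Q, IQ)`. -/
def ETransSpRel (ω : SymplecticForm R P) (I : Ideal R) :
    Subgroup ((R × R × P) ≃ₗ[R] (R × R × P)) :=
  relNormalClosure (ETransSp ω) (ETransSpIdeal ω I)

/-- The standard alternating matrix `ψ_n = ∑ e_{2i-1,2i} - ∑ e_{2i,2i-1}` (indices shifted to
start at `0`). -/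
def psi (A : Type*) [CommRing A] (n : ℕ) : Matrix (Fin (2 * n)) (Fin (2 * n)) A :=
  Matrix.of fun i j =>
    if Even i.val ∧ j.val = i.val + 1 then 1
    else if Even j.val ∧ i.val = j.val + 1 then -1
    else 0

/-- At every maximal ideal `m`, the form is given in some basis of `P_m` by a matrix `φ_m` over
`R_m` with `φ_m ≡ ψ_n` modulo `I_m`. -/
def LocallyCongruentPsi (ω : SymplecticForm R P) (I : Ideal R) (n : ℕ) : Prop :=
  ∀ (m : Ideal R) [m.IsMaximal],
    ∃ b : Module.Basis (Fin (2 * n)) (Localization.AtPrime m) (Localization.AtPrime m ⊗[R] P),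
      ∀ i j, ω.form.baseChange (Localization.AtPrime m) (b i) (b j) -
          psi (Localization.AtPrime m) n i j ∈
        I.map (algebraMap R (Localization.AtPrime m))

end Symplectic

end TransvectionOrbits

/-! Every symplectic generator is a linear generator times a commutator of linear ones, also in the
relative setting; this gives one inclusion.

For the other, `linE (c, q)` differs from `sympRho ω q c` only by a shift of `b` by `⟨p, q⟩`. The
key is that, for `q ∈ IP`, this shift stays in the relative symplectic orbit of a unimodular `(a, b,
p)` (`spRel_add_form`). Multiplying `⟨p, q⟩` by `1 = a r - s b + ⟨p, u⟩` leaves three kinds of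
shift: a multiple of `a`, which is a generator; `⟨p, q⟩⟨p, u⟩`, polarised from squares since `2` is
invertible; and a multiple of `b⟨p, q⟩` (`spRel_mul_form`).

It remains to treat conjugates by `g ∈ ETrans`. The case `I = R` shows that `g` moves each
unimodular vector as some `k ∈ ETransSp` does. A conjugated linear generator has the form `z ↦ z +
φ(z) y`, where `y` or `φ` comes from a vector of the hyperbolic plane moved by `g` or by an adjoint.
Replacing that motion by `k` turns the conjugate into a `k`-conjugate of a linear generator at level
`I`, and `ETransSp` normalises the orbit-preserving maps. -/

namespace TransvectionOrbits

/-! ### Relative normal closures -/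

section NormalClosure

variable {A : Type*} [Group A] {G H : Subgroup A}

theorem relNormalClosure_le : relNormalClosure G H ≤ G := by
  rintro _ ⟨x, -, rfl⟩
  exact x.2

theorem mem_relNormalClosure {h : A} (hG : h ∈ G) (hH : h ∈ H) : h ∈ relNormalClosure G H :=
  ⟨⟨h, hG⟩, Subgroup.subset_normalClosure (Subgroup.mem_subgroupOf.2 hH), rfl⟩

theorem conj_mem_relNormalClosure {g h : A} (hg : g ∈ G) (hh : h ∈ relNormalClosure G H) :
    g * h * g⁻¹ ∈ relNormalClosure G H := by
  obtain ⟨x, hx, rfl⟩ := hh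
  exact ⟨⟨g, hg⟩ * x * ⟨g, hg⟩⁻¹, Subgroup.normalClosure_normal.conj_mem x hx ⟨g, hg⟩, rfl⟩

theorem relNormalClosure_le_of_conj {K : Subgroup A}
    (h : ∀ g ∈ G, ∀ x ∈ H, g * x * g⁻¹ ∈ K) : relNormalClosure G H ≤ K := by
  rw [relNormalClosure, Subgroup.map_le_iff_le_comap, Subgroup.normalClosure,
    Subgroup.closure_le]
  intro x hx
  obtain ⟨y, hy, hc⟩ := Group.mem_conjugatesOfSet_iff.1 hx
  obtain ⟨c, rfl⟩ := isConj_iff.1 hc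
  exact h c c.2 y (Subgroup.mem_subgroupOf.1 hy)

end NormalClosure

/-! ### Coordinate shifts inside a relative symplectic orbit -/

section Shift

variable {R : Type*} [CommRing R] {P : Type*} [AddCommGroup P] [Module R P]
variable {ω : SymplecticForm R P} {I : Ideal R}

theorem SymplecticForm.self_eq_zero (ω : SymplecticForm R P) (x : P) : ω.form x x = 0 := ω.alt x

theorem SymplecticForm.swap (ω : SymplecticForm R P) (x y : P) : ω.form x y = -ω.form y x :=
  (ω.alt.neg_eq y x).symm

@[simp] theorem sympRho_apply (q : P) (α : R) (z : R × R × P) :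
    sympRho ω q α z = (z.1, z.2.1 + ω.form z.2.2 q + α * z.1, z.2.2 + z.1 • q) := rfl

@[simp] theorem sympMu_apply (q : P) (β : R) (z : R × R × P) :
    sympMu ω q β z = (z.1 - ω.form z.2.2 q - β * z.2.1, z.2.1, z.2.2 + z.2.1 • q) := rfl

@[simp] theorem sympRho_inv_apply (q : P) (α : R) (z : R × R × P) :
    (sympRho ω q α)⁻¹ z = (z.1, z.2.1 - ω.form z.2.2 q - α * z.1, z.2.2 - z.1 • q) := rfl

@[simp] theorem sympMu_inv_apply (q : P) (β : R) (z : R × R × P) :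
    (sympMu ω q β)⁻¹ z = (z.1 + ω.form z.2.2 q + β * z.2.1, z.2.1, z.2.2 - z.2.1 • q) := rfl

theorem sympRho_mem (q : P) (α : R) : sympRho ω q α ∈ ETransSp ω :=
  Subgroup.subset_closure (Or.inl ⟨q, α, rfl⟩)

theorem sympMu_mem (q : P) (β : R) : sympMu ω q β ∈ ETransSp ω :=
  Subgroup.subset_closure (Or.inr ⟨q, β, rfl⟩)

theorem sympRho_mem_rel {q : P} (hq : q ∈ (I • ⊤ : Submodule R P)) {α : R} (hα : α ∈ I) :
    sympRho ω q α ∈ ETransSpRel ω I :=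
  mem_relNormalClosure (sympRho_mem q α) (Subgroup.subset_closure (Or.inl ⟨q, hq, α, hα, rfl⟩))

theorem sympMu_mem_rel {q : P} (hq : q ∈ (I • ⊤ : Submodule R P)) {β : R} (hβ : β ∈ I) :
    sympMu ω q β ∈ ETransSpRel ω I :=
  mem_relNormalClosure (sympMu_mem q β) (Subgroup.subset_closure (Or.inr ⟨q, hq, β, hβ, rfl⟩))

variable (ω I) in
/-- Two vectors of `Q` lie in the same orbit of `ETrans_Sp(Q, IQ)`. -/
def SpRel (v w : R × R × P) : Prop := ∃ h ∈ ETransSpRel ω I, h v = w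

theorem SpRel.refl (v : R × R × P) : SpRel ω I v v := ⟨1, one_mem _, rfl⟩

theorem SpRel.symm {v w : R × R × P} : SpRel ω I v w → SpRel ω I w v := by
  rintro ⟨h, hh, rfl⟩
  exact ⟨h⁻¹, inv_mem hh, h.symm_apply_apply v⟩

theorem SpRel.trans {u v w : R × R × P} : SpRel ω I u v → SpRel ω I v w → SpRel ω I u w := by
  rintro ⟨h, hh, rfl⟩ ⟨k, hk, rfl⟩
  exact ⟨k * h, mul_mem hk hh, rfl⟩

theorem SpRel.map {v w : R × R × P} {g : (R × R × P) ≃ₗ[R] (R × R × P)} (hg : g ∈ ETransSp ω) :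
    SpRel ω I v w → SpRel ω I (g v) (g w) := by
  rintro ⟨h, hh, rfl⟩
  refine ⟨g * h * g⁻¹, conj_mem_relNormalClosure hg hh, ?_⟩
  exact congrArg (fun x => g (h x)) (g.symm_apply_apply v)

theorem SpRel.of_map {v w : R × R × P} {g : (R × R × P) ≃ₗ[R] (R × R × P)} (hg : g ∈ ETransSp ω)
    (h : SpRel ω I (g v) (g w)) : SpRel ω I v w := by
  have := h.map (inv_mem hg)
  rwa [show g⁻¹ (g v) = v from g.symm_apply_apply v,
    show g⁻¹ (g w) = w from g.symm_apply_apply w] at this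

theorem spRel_rho {q : P} (hq : q ∈ (I • ⊤ : Submodule R P)) {α : R} (hα : α ∈ I)
    (a b : R) (p : P) : SpRel ω I (a, b, p) (a, b + ω.form p q + α * a, p + a • q) :=
  ⟨_, sympRho_mem_rel hq hα, rfl⟩

theorem spRel_mu {q : P} (hq : q ∈ (I • ⊤ : Submodule R P)) {β : R} (hβ : β ∈ I)
    (a b : R) (p : P) : SpRel ω I (a, b, p) (a - ω.form p q - β * b, b, p + b • q) :=
  ⟨_, sympMu_mem_rel hq hβ, rfl⟩

theorem spRel_add_left {β : R} (hβ : β ∈ I) (a b : R) (p : P) :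
    SpRel ω I (a, b, p) (a + β * b, b, p) := by
  simpa using spRel_mu (ω := ω) (q := 0) (zero_mem _) (neg_mem hβ) a b p

theorem spRel_add_right {α : R} (hα : α ∈ I) (a b : R) (p : P) :
    SpRel ω I (a, b, p) (a, b + α * a, p) := by
  simpa using spRel_rho (ω := ω) (q := 0) (zero_mem _) hα a b p

theorem form_mem_of_mem_smul_top {q : P} (hq : q ∈ (I • ⊤ : Submodule R P)) (p : P) :
    ω.form p q ∈ I := by
  induction hq using Submodule.smul_induction_on' with
  | smul r hr n _ => simpa using I.mul_mem_right _ hr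
  | add x _ y _ hx hy => simpa using add_mem hx hy

/-- The rotation of the hyperbolic plane, as an elementary symplectic transformation. -/
theorem exists_rotation (ω : SymplecticForm R P) :
    ∃ g ∈ ETransSp ω, ∀ (a b : R) (p : P), g (a, b, p) = (b, -a, p) := by
  refine ⟨sympMu ω 0 (-1) * sympRho ω 0 (-1) * sympMu ω 0 (-1),
    mul_mem (mul_mem (sympMu_mem _ _) (sympRho_mem _ _)) (sympMu_mem _ _), fun a b p => ?_⟩
  simp [LinearEquiv.mul_apply]

/-- Commutator of two opposite transvections along the same line `Rx`: as `⟨x, x⟩ = 0`, the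
hyperbolic coordinates return to their values. Only one factor has to be relative. -/
theorem spRel_longTransvection (h2 : IsUnit (2 : R)) {α : R} {x : P}
    (hx : α • x ∈ (I • ⊤ : Submodule R P)) (a b : R) (p : P) :
    SpRel ω I (a, b, p) (a, b, p + (α * ω.form p x) • x) := by
  obtain ⟨c, hc⟩ := h2.exists_right_inv
  -- The commutator contributes `-2β⟨p, x⟩x`, hence `β = -α/2`.
  set β : R := -(c * α) with hβ
  have hy : β • x ∈ (I • ⊤ : Submodule R P) := by
    rw [hβ, neg_smul, mul_smul]
    exact neg_mem (Submodule.smul_mem _ _ hx)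
  have hY : sympMu ω (β • x) 0 ∈ ETransSpRel ω I := sympMu_mem_rel hy (zero_mem _)
  refine ⟨(sympRho ω x 0 * sympMu ω (β • x) 0 * (sympRho ω x 0)⁻¹) * (sympMu ω (β • x) 0)⁻¹,
    mul_mem (conj_mem_relNormalClosure (sympRho_mem _ _) hY) (inv_mem hY), ?_⟩
  have e : α = -(2 * β) := by linear_combination -α * hc
  simp only [LinearEquiv.mul_apply, sympRho_apply, sympMu_apply, sympRho_inv_apply,
    sympMu_inv_apply, map_add, map_sub, map_smul, LinearMap.add_apply, LinearMap.sub_apply,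
    LinearMap.smul_apply, ω.self_eq_zero x, smul_eq_mul]
  refine Prod.ext ?_ (Prod.ext ?_ ?_)
  · ring
  · ring
  · simp only [e]
    module

/-- `sympRho` along `α⟨p, y⟩y` produces the square but also moves `p` along `y`; a long transvection
moves `p` back, since `⟨p, y⟩` is unaffected. -/
theorem spRel_sub_sq (h2 : IsUnit (2 : R)) {α : R} (hα : α ∈ I) (y : P) (a b : R) (p : P) :
    SpRel ω I (a, b, p) (a, b + α * ω.form p y ^ 2, p) := by
  have hq : (α * ω.form p y) • y ∈ (I • ⊤ : Submodule R P) :=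
    Submodule.smul_mem_smul (I.mul_mem_right _ hα) trivial
  have hx : (-(a * α)) • y ∈ (I • ⊤ : Submodule R P) :=
    Submodule.smul_mem_smul (neg_mem (I.mul_mem_left _ hα)) trivial
  convert (spRel_rho hq (zero_mem I) a b p).trans (spRel_longTransvection h2 hx _ _ _) using 3
  · simp [pow_two, mul_assoc]
  · simp only [map_add, map_smul, LinearMap.add_apply, LinearMap.smul_apply, ω.self_eq_zero y,
      smul_eq_mul]
    module

variable (ω I) in
/-- The amounts by which the second coordinate of every vector `(a, b, p)` can be changed. -/
def shiftSubgroup (a : R) (p : P) : AddSubgroup R where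
  carrier := {x | ∀ b, SpRel ω I (a, b, p) (a, b + x, p)}
  zero_mem' b := by simpa using SpRel.refl _
  add_mem' hx hy b := by simpa [add_assoc] using (hx b).trans (hy _)
  neg_mem' {x} hx b := by simpa using (hx (b + -x)).symm

theorem mul_mem_shiftSubgroup {α : R} (hα : α ∈ I) (a : R) (p : P) :
    α * a ∈ shiftSubgroup ω I a p := fun b => spRel_add_right hα a b p

theorem form_mul_form_mem_shiftSubgroup (h2 : IsUnit (2 : R)) {q : P}
    (hq : q ∈ (I • ⊤ : Submodule R P)) (u : P) (a : R) (p : P) :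
    ω.form p q * ω.form p u ∈ shiftSubgroup ω I a p := by
  obtain ⟨c, hc⟩ := h2.exists_right_inv
  induction hq using Submodule.smul_induction_on' with
  | smul r hr n _ =>
    have h (y : P) : c * r * ω.form p y ^ 2 ∈ shiftSubgroup ω I a p :=
      fun b => spRel_sub_sq h2 (I.mul_mem_left _ hr) y a b p
    -- Polarisation; the factor `c = 1/2` in `h` absorbs the `2` of the cross term.
    have := sub_mem (sub_mem (h (n + u)) (h n)) (h u)
    convert this using 1
    simp only [map_smul, map_add, smul_eq_mul]
    linear_combination -(r * ω.form p n * ω.form p u) * hc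
  | add x _ y _ hx hy => simpa [add_mul] using add_mem hx hy

theorem spRel_shift_left {x a b : R} {p : P} (hx : x ∈ shiftSubgroup ω I b p) :
    SpRel ω I (a, b, p) (a + x, b, p) := by
  obtain ⟨g, hg, h⟩ := exists_rotation ω
  refine SpRel.of_map hg ?_
  rw [h, h]
  simpa [add_comm] using neg_mem hx (-a)

/-- Transvections along `bq` and `-aq` scale `b` and then `a`; the remaining error `-ab⟨p, q⟩q` in
`p` is that of a long transvection. -/
theorem spRel_scale (h2 : IsUnit (2 : R)) {q : P} (hq : q ∈ (I • ⊤ : Submodule R P))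
    (a b : R) (p : P) :
    SpRel ω I (a, b, p) (a * (1 + ω.form p q), b * (1 + ω.form p q), p) := by
  have h1 := spRel_rho (ω := ω) (Submodule.smul_mem _ b hq) (zero_mem I) a b p
  have h3 := h1.trans (spRel_mu (Submodule.smul_mem _ (-a) hq) (zero_mem I) _ _ _)
  convert h3.trans (spRel_longTransvection h2 (Submodule.smul_mem _ (a * b) hq) _ _ _) using 3
  · simp [ω.self_eq_zero q]; ring
  · simp; ring
  · simp only [map_add, map_smul, LinearMap.add_apply, LinearMap.smul_apply, ω.self_eq_zero q,
      smul_eq_mul]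
    module

/-- A relative substitute for `diag(1 - μ, 1 + μ)`, correct modulo `μ²`: an elementary matrix of
level `I` conjugated by a non-relative one has this diagonal, and two relative shears clear the
linear off-diagonal terms. -/
theorem spRel_hyperbolic {μ : R} (hμ : μ ∈ I) (a b : R) (p : P) :
    SpRel ω I (a, b, p)
      (a * (1 - μ + μ ^ 3) - b * (μ ^ 2 + μ ^ 3), b * (1 + μ + μ ^ 2) - a * μ ^ 2, p) := by
  have h : SpRel ω I (a, b, p) (a * (1 - μ) + b * μ, b * (1 + μ) - a * μ, p) := by
    refine SpRel.of_map (sympMu_mem 0 1) ?_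
    convert spRel_add_right (ω := ω) (neg_mem hμ) (a - b) b p using 1
    · simp
    · simp
      constructor <;> ring
  convert (h.trans (spRel_add_right hμ _ _ _)).trans (spRel_add_left (neg_mem hμ) _ _ _)
    using 3 <;> ring

/-- With `μ = ⟨p, q⟩/2`, scaling by `1 + μ` followed by approximately `diag(1 - μ, 1 + μ)` fixes `a`
and multiplies `b` by `1 + 2μ`, modulo `μ²`. Multiples of `μ²` are admissible shifts of either
coordinate. -/
theorem spRel_mul_form (h2 : IsUnit (2 : R)) {q : P} (hq : q ∈ (I • ⊤ : Submodule R P))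
    (a b : R) (p : P) : SpRel ω I (a, b, p) (a, b + b * ω.form p q, p) := by
  obtain ⟨c, hc⟩ := h2.exists_right_inv
  have hcq := Submodule.smul_mem _ c hq
  set μ := ω.form p (c • q) with hμ
  have hμ2 : ω.form p q = 2 * μ := by
    simp only [hμ, map_smul, smul_eq_mul]
    linear_combination -ω.form p q * hc
  have hsq (r a : R) : r * μ ^ 2 ∈ shiftSubgroup ω I a p := by
    convert form_mul_form_mem_shiftSubgroup (ω := ω) h2 (Submodule.smul_mem _ r hcq) (c • q) a p
      using 1
    rw [map_smul, smul_eq_mul]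
    ring
  have h := (spRel_scale (ω := ω) h2 hcq a b p).trans
    (spRel_hyperbolic (form_mem_of_mem_smul_top (ω := ω) hcq p) _ _ _)
  rw [← hμ] at h
  -- The coefficients here and in the next shift are those cancelling the `μ²` remainders exactly.
  have h' := h.trans (spRel_shift_left (hsq (a * (1 - μ - μ ^ 2) + b * (1 + μ) ^ 2) _))
  convert h'.trans (hsq (a * (1 + μ) - b * (2 + μ)) _ _) using 3
  · ring
  · rw [hμ2]; ring

/-- Adding `⟨p, q⟩`, `q ∈ IP`, to the second coordinate of a unimodular vector `(a, b, p)` does not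
change its orbit under `ETrans_Sp(Q, IQ)`. -/
theorem spRel_add_form (h2 : IsUnit (2 : R)) {q : P} (hq : q ∈ (I • ⊤ : Submodule R P))
    {a b : R} {p : P} (hv : ∃ z, formQ ω.form (a, b, p) z = 1) :
    SpRel ω I (a, b, p) (a, b + ω.form p q, p) := by
  obtain ⟨⟨s, r, u⟩, hz⟩ := hv
  simp only [formQ_apply] at hz
  have h1 := spRel_mul_form (ω := ω) h2 (Submodule.smul_mem _ (-s) hq) a b p
  have h3 := h1.trans (mul_mem_shiftSubgroup
    (I.mul_mem_left r (form_mem_of_mem_smul_top (ω := ω) hq p)) a p _)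
  convert h3.trans (form_mul_form_mem_shiftSubgroup h2 hq u a p _) using 3
  rw [map_smul, smul_eq_mul]
  linear_combination -ω.form p q * hz

end Shift

/-! ### Commutators of linear transvections -/

section LinearTransvections

variable {R : Type*} [CommRing R] {M : Type*} [AddCommGroup M] [Module R M] {I : Ideal R}

@[simp] theorem linE_apply (x : M) (z : R × M) : linE x z = (z.1, z.2 + z.1 • x) := rfl

@[simp] theorem linE_inv_apply (x : M) (z : R × M) :
    (linE (R := R) x)⁻¹ z = (z.1, z.2 - z.1 • x) := rfl

@[simp] theorem linEStar_apply (τ : Module.Dual R M) (z : R × M) :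
    linEStar τ z = (z.1 + τ z.2, z.2) := rfl

@[simp] theorem linEStar_inv_apply (τ : Module.Dual R M) (z : R × M) :
    (linEStar τ)⁻¹ z = (z.1 - τ z.2, z.2) := rfl

theorem linE_mem (x : M) : linE x ∈ ETrans R M := Subgroup.subset_closure (Or.inl ⟨x, rfl⟩)

theorem linEStar_mem (τ : Module.Dual R M) : linEStar τ ∈ ETrans R M :=
  Subgroup.subset_closure (Or.inr ⟨τ, rfl⟩)

theorem linE_mem_rel {x : M} (hx : x ∈ (I • ⊤ : Submodule R M)) : linE x ∈ ETransRel M I :=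
  mem_relNormalClosure (linE_mem x) (Subgroup.subset_closure (Or.inl ⟨x, hx, rfl⟩))

theorem linEStar_mem_rel {τ : Module.Dual R M} (hτ : τ ∈ (I • ⊤ : Submodule R (Module.Dual R M))) :
    linEStar τ ∈ ETransRel M I :=
  mem_relNormalClosure (linEStar_mem τ) (Subgroup.subset_closure (Or.inr ⟨τ, hτ, rfl⟩))

theorem commutator_linE_linEStar_apply {x : M} {φ : Module.Dual R M} (h : φ x = 0) (z : R × M) :
    (linE x * linEStar φ * (linE x)⁻¹ * (linEStar φ)⁻¹ : (R × M) ≃ₗ[R] (R × M)) z =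
      (z.1, z.2 + φ z.2 • x) := by
  simp only [LinearEquiv.mul_apply, linE_apply, linE_inv_apply, linEStar_apply,
    linEStar_inv_apply, map_sub, map_smul, h, smul_zero, sub_zero, sub_add_cancel]
  refine Prod.ext rfl ?_
  module

theorem exists_mem_ETrans {x : M} {φ : Module.Dual R M} (h : φ x = 0) :
    ∃ g ∈ ETrans R M, ∀ z, g z = (z.1, z.2 + φ z.2 • x) :=
  ⟨_, mul_mem (mul_mem (mul_mem (linE_mem x) (linEStar_mem φ)) (inv_mem (linE_mem x)))
    (inv_mem (linEStar_mem φ)), commutator_linE_linEStar_apply h⟩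

theorem exists_mem_ETransRel_of_mem_dual {x : M} {φ : Module.Dual R M} (h : φ x = 0)
    (hφ : φ ∈ (I • ⊤ : Submodule R (Module.Dual R M))) :
    ∃ g ∈ ETransRel M I, ∀ z, g z = (z.1, z.2 + φ z.2 • x) :=
  ⟨_, mul_mem (conj_mem_relNormalClosure (linE_mem x) (linEStar_mem_rel hφ))
    (inv_mem (linEStar_mem_rel hφ)), commutator_linE_linEStar_apply h⟩

theorem exists_mem_ETransRel_of_mem {x : M} {φ : Module.Dual R M} (h : φ x = 0)
    (hx : x ∈ (I • ⊤ : Submodule R M)) :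
    ∃ g ∈ ETransRel M I, ∀ z, g z = (z.1, z.2 + φ z.2 • x) := by
  refine ⟨_, mul_mem (linE_mem_rel hx)
    (conj_mem_relNormalClosure (linEStar_mem φ) (inv_mem (linE_mem_rel hx))), fun z => ?_⟩
  rw [← commutator_linE_linEStar_apply h, mul_assoc, mul_assoc, mul_assoc]

end LinearTransvections

/-! ### Comparison of the linear and symplectic groups -/

section Comparison

variable {R : Type*} [CommRing R] {P : Type*} [AddCommGroup P] [Module R P]
variable {ω : SymplecticForm R P} {I : Ideal R}

theorem map_mem_smul_top {M N : Type*} [AddCommGroup M] [Module R M] [AddCommGroup N] [Module R N]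
    (f : M →ₗ[R] N) {x : M} (hx : x ∈ (I • ⊤ : Submodule R M)) :
    f x ∈ (I • ⊤ : Submodule R N) :=
  Submodule.smul_top_le_comap_smul_top I f hx

theorem dual_apply_mem {M : Type*} [AddCommGroup M] [Module R M] (f : Module.Dual R M) {x : M}
    (hx : x ∈ (I • ⊤ : Submodule R M)) : f x ∈ I := by
  simpa using map_mem_smul_top f hx

/-- For `q ∈ IP` the functional `(b, p) ↦ ⟨p, q⟩` lies in `I(R ⊕ P)*`. -/
theorem flip_mem_smul_top (ω : SymplecticForm R P) {q : P} (hq : q ∈ (I • ⊤ : Submodule R P)) :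
    ω.form.flip q ∘ₗ LinearMap.snd R R P ∈ (I • ⊤ : Submodule R (Module.Dual R (R × P))) :=
  map_mem_smul_top ((LinearMap.lcomp R R (LinearMap.snd R R P)) ∘ₗ ω.form.flip) hq

theorem sympRho_mem_of_linE_mem (q : P) (α : R) {K : Subgroup ((R × R × P) ≃ₗ[R] (R × R × P))}
    (h1 : linE (α, q) ∈ K)
    (h3 : ∃ g ∈ K, ∀ z : R × R × P,
      g z = (z.1, z.2 + (ω.form.flip q ∘ₗ LinearMap.snd R R P) z.2 • ((1, 0) : R × P))) :
    sympRho ω q α ∈ K := by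
  obtain ⟨g, hg, h⟩ := h3
  convert mul_mem h1 hg using 1
  ext z <;> simp [LinearEquiv.mul_apply, h, mul_comm]

theorem sympMu_mem_of_linEStar_mem (q : P) (β : R) {K : Subgroup ((R × R × P) ≃ₗ[R] (R × R × P))}
    (h1 : linEStar (-(β • LinearMap.fst R R P + ω.form.flip q ∘ₗ LinearMap.snd R R P)) ∈ K)
    (h3 : ∃ g ∈ K, ∀ z : R × R × P,
      g z = (z.1, z.2 + LinearMap.fst R R P z.2 • ((0, q) : R × P))) :
    sympMu ω q β ∈ K := by
  obtain ⟨g, hg, h⟩ := h3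
  convert mul_mem h1 hg using 1
  ext z <;> simp [LinearEquiv.mul_apply, h, ω.self_eq_zero q]
  ring

theorem ETransSp_le_ETrans (ω : SymplecticForm R P) : ETransSp ω ≤ ETrans R (R × P) := by
  rw [ETransSp, Subgroup.closure_le]
  rintro _ (⟨q, α, rfl⟩ | ⟨q, β, rfl⟩)
  · exact sympRho_mem_of_linE_mem q α (linE_mem _) (exists_mem_ETrans (by simp))
  · exact sympMu_mem_of_linEStar_mem q β (linEStar_mem _) (exists_mem_ETrans (by simp))

theorem ETransSpRel_le_ETransRel (ω : SymplecticForm R P) (I : Ideal R) :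
    ETransSpRel ω I ≤ ETransRel (R × P) I := by
  have h : ETransSpIdeal ω I ≤ ETransRel (R × P) I := by
    rw [ETransSpIdeal, Subgroup.closure_le]
    rintro _ (⟨q, hq, α, hα, rfl⟩ | ⟨q, hq, β, hβ, rfl⟩)
    · refine sympRho_mem_of_linE_mem q α (linE_mem_rel ?_)
        (exists_mem_ETransRel_of_mem_dual (by simp) (flip_mem_smul_top ω hq))
      have h1 : α ∈ (I • ⊤ : Submodule R R) := by simpa using hα
      simpa using add_mem (map_mem_smul_top (LinearMap.inl R R P) h1)
        (map_mem_smul_top (LinearMap.inr R R P) hq)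
    · refine sympMu_mem_of_linEStar_mem q β (linEStar_mem_rel ?_)
        (exists_mem_ETransRel_of_mem (by simp) (map_mem_smul_top (LinearMap.inr R R P) hq))
      exact neg_mem (add_mem (Submodule.smul_mem_smul hβ trivial) (flip_mem_smul_top ω hq))
  exact relNormalClosure_le_of_conj fun g hg x hx =>
    conj_mem_relNormalClosure (ETransSp_le_ETrans ω hg) (h hx)

theorem exists_form_eq (ω : SymplecticForm R P) {φ : Module.Dual R P}
    (hφ : φ ∈ (I • ⊤ : Submodule R (Module.Dual R P))) :
    ∃ q ∈ (I • ⊤ : Submodule R P), ∀ p, ω.form p q = φ p := by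
  set e : P ≃ₗ[R] Module.Dual R P := LinearEquiv.ofBijective ω.form ω.nondeg
  refine ⟨-e.symm φ, neg_mem (map_mem_smul_top e.symm.toLinearMap hφ), fun p => ?_⟩
  rw [ω.swap, map_neg, LinearMap.neg_apply, neg_neg]
  exact LinearMap.congr_fun (e.apply_symm_apply φ) p

theorem exists_dual_prod_eq (ω : SymplecticForm R P) {τ : Module.Dual R (R × P)}
    (hτ : τ ∈ (I • ⊤ : Submodule R (Module.Dual R (R × P)))) :
    ∃ c ∈ I, ∃ q ∈ (I • ⊤ : Submodule R P), ∀ b p, τ (b, p) = c * b + ω.form p q := by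
  obtain ⟨q, hq, h⟩ := exists_form_eq ω
    (map_mem_smul_top (LinearMap.lcomp R R (LinearMap.inr R R P)) hτ)
  refine ⟨τ (1, 0), dual_apply_mem (LinearMap.applyₗ (R := R) ((1, 0) : R × P)) hτ, q, hq,
    fun b p => ?_⟩
  rw [h, mul_comm, ← smul_eq_mul, ← map_smul]
  simp [← map_add]

theorem exists_formQ_eq (ω : SymplecticForm R P) (φ : Module.Dual R (R × R × P)) :
    ∃ z, ∀ v, formQ ω.form v z = φ v := by
  obtain ⟨c, -, q, -, h⟩ := exists_dual_prod_eq (I := ⊤) ω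
    (τ := φ ∘ₗ LinearMap.inr R R (R × P)) (by simp)
  refine ⟨(-c, φ (1, 0, 0), q), fun ⟨a, b, p⟩ => ?_⟩
  have h1 : φ (a, b, p) = a * φ (1, 0, 0) + φ (0, b, p) := by
    rw [← smul_eq_mul, ← map_smul, ← map_add]
    simp
  have h3 : φ (0, b, p) = c * b + ω.form p q := h b p
  rw [h1, h3, formQ_apply]
  ring

theorem formQ_map (k : (R × R × P) ≃ₗ[R] (R × R × P)) (hk : k ∈ ETransSp ω) (y z : R × R × P) :
    formQ ω.form (k y) (k z) = formQ ω.form y z := by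
  induction hk using Subgroup.closure_induction generalizing y z with
  | mem x hx =>
    rcases hx with ⟨q, α, rfl⟩ | ⟨q, β, rfl⟩
    · exact sympRho_isometry ω q α y z
    · exact sympMu_isometry ω q β y z
  | one => rfl
  | mul g h _ _ hg hh => exact (hg _ _).trans (hh _ _)
  | inv g _ hg =>
    rw [← hg (g⁻¹ y) (g⁻¹ z)]
    exact congrArg₂ (fun a b => formQ ω.form a b) (g.apply_symm_apply y) (g.apply_symm_apply z)

/-- Lets the functional `z ↦ (g z).1 = ⟨g z, (0, 1, 0)⟩` be written as pairing with the image of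
`(0, 1, 0)` under an element of `ETrans`. -/
theorem exists_adjoint (ω : SymplecticForm R P) (g : (R × R × P) ≃ₗ[R] (R × R × P))
    (hg : g ∈ ETrans R (R × P)) :
    ∃ g' ∈ ETrans R (R × P), ∀ y z, formQ ω.form (g y) z = formQ ω.form y (g' z) := by
  induction hg using Subgroup.closure_induction with
  | mem x hx =>
    rcases hx with ⟨⟨c, q⟩, rfl⟩ | ⟨τ, rfl⟩
    · obtain ⟨g, hg, h⟩ := exists_mem_ETrans (R := R) (x := ((1, 0) : R × P))
        (φ := ω.form q ∘ₗ LinearMap.snd R R P) (by simp)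
      refine ⟨linE (-c, 0) * g, mul_mem (linE_mem _) hg, fun y z => ?_⟩
      simp [LinearEquiv.mul_apply, h]
      ring
    · obtain ⟨c, -, q, -, hτ⟩ := exists_dual_prod_eq (I := ⊤) ω (τ := τ) (by simp)
      obtain ⟨g, hg, h⟩ := exists_mem_ETrans (R := R) (x := ((0, q) : R × P))
        (φ := LinearMap.fst R R P) (by simp)
      refine ⟨linEStar (-c • LinearMap.fst R R P) * g, mul_mem (linEStar_mem _) hg, ?_⟩
      rintro ⟨a, b, p⟩ z
      simp [LinearEquiv.mul_apply, h, hτ]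
      ring
  | one => exact ⟨1, one_mem _, fun _ _ => rfl⟩
  | mul g h _ _ hg hh =>
    obtain ⟨g', hg', eg⟩ := hg
    obtain ⟨h', hh', eh⟩ := hh
    exact ⟨h' * g', mul_mem hh' hg', fun y z => (eg _ _).trans (eh _ _)⟩
  | inv g _ hg =>
    obtain ⟨g', hg', eg⟩ := hg
    refine ⟨g'⁻¹, inv_mem hg', fun y z => ?_⟩
    have h1 : g (g⁻¹ y) = y := g.apply_symm_apply y
    have h3 : g' (g'⁻¹ z) = z := g'.apply_symm_apply z
    conv_lhs => rw [← h3, ← eg, h1]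

/-! ### Linear maps preserving symplectic orbits of unimodular vectors -/

variable (ω I) in
/-- The automorphisms of `Q` that map every unimodular vector into its orbit under
`ETrans_Sp(Q, IQ)`. -/
def orbitPreserving : Subgroup ((R × R × P) ≃ₗ[R] (R × R × P)) where
  carrier := {g | ∀ v, (∃ z, formQ ω.form v z = 1) → SpRel ω I v (g v)}
  one_mem' v _ := SpRel.refl v
  mul_mem' {g h} hg hh v hv := by
    refine (hh v hv).trans (hg _ ?_)
    obtain ⟨k, hk, e⟩ := hh v hv
    obtain ⟨z, hz⟩ := hv
    exact ⟨k z, by rw [← e, formQ_map k (relNormalClosure_le hk), hz]⟩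
  inv_mem' {g} hg v hv := by
    have e : g (g⁻¹ v) = v := g.apply_symm_apply v
    obtain ⟨z, hz⟩ := hv
    -- `g⁻¹ v` is unimodular: the functional `⟨g ·, z⟩` takes the value `1` on it and is represented
    -- by `y`.
    obtain ⟨y, hy⟩ := exists_formQ_eq ω ((formQ ω.form).flip z ∘ₗ g.toLinearMap)
    have := hg (g⁻¹ v) ⟨y, by
      rw [hy, LinearMap.comp_apply, LinearEquiv.coe_coe, e, ← hz]; rfl⟩
    rw [e] at this
    exact this.symm

theorem conj_mem_orbitPreserving {k g : (R × R × P) ≃ₗ[R] (R × R × P)} (hk : k ∈ ETransSp ω)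
    (hg : g ∈ orbitPreserving ω I) : k * g * k⁻¹ ∈ orbitPreserving ω I := by
  rintro v ⟨z, hz⟩
  have := (hg (k⁻¹ v) ⟨k⁻¹ z, by rw [formQ_map _ (inv_mem hk), hz]⟩).map hk
  rwa [show k (k⁻¹ v) = v from k.apply_symm_apply v] at this

theorem linE_mem_orbitPreserving (h2 : IsUnit (2 : R)) {x : R × P}
    (hx : x ∈ (I • ⊤ : Submodule R (R × P))) : linE x ∈ orbitPreserving ω I := by
  obtain ⟨c, q⟩ := x
  have hc : c ∈ I := dual_apply_mem (LinearMap.fst R R P) hx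
  have hq : q ∈ (I • ⊤ : Submodule R P) := map_mem_smul_top (LinearMap.snd R R P) hx
  rintro ⟨a, b, p⟩ ⟨z, hz⟩
  refine (spRel_rho hq hc a b p).trans ?_
  convert spRel_add_form h2 (neg_mem hq)
    ⟨sympRho ω q c z, by rw [← hz]; exact formQ_map _ (sympRho_mem q c) (a, b, p) z⟩ using 1
  simp [ω.self_eq_zero q]
  ring

theorem linEStar_mem_orbitPreserving (h2 : IsUnit (2 : R)) {τ : Module.Dual R (R × P)}
    (hτ : τ ∈ (I • ⊤ : Submodule R (Module.Dual R (R × P)))) :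
    linEStar τ ∈ orbitPreserving ω I := by
  obtain ⟨c, hc, q, hq, h⟩ := exists_dual_prod_eq ω hτ
  obtain ⟨g, hg, hr⟩ := exists_rotation ω
  rintro ⟨a, b, p⟩ ⟨z, hz⟩
  refine (spRel_add_left hc a b p).trans (SpRel.of_map hg ?_)
  rw [hr, linEStar_apply, hr]
  obtain ⟨⟨r, s, u⟩, hz⟩ : ∃ z, formQ ω.form (a, b, p) z = 1 := ⟨z, hz⟩
  have hu : ∃ z, formQ ω.form (b, -(a + c * b), p) z = 1 := by
    -- The image of `(r, s, u)` under the same two isometries, the shear by `c` and the rotation.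
    refine ⟨(s, -(r + c * s), u), ?_⟩
    rw [← hz]
    simp
    ring
  convert spRel_add_form h2 (neg_mem hq) hu using 3
  simp [h]
  ring

theorem ETrans_le_orbitPreserving (h2 : IsUnit (2 : R)) :
    ETrans R (R × P) ≤ orbitPreserving ω ⊤ := by
  rw [ETrans, Subgroup.closure_le]
  rintro _ (⟨x, rfl⟩ | ⟨τ, rfl⟩)
  · exact linE_mem_orbitPreserving h2 (by simp)
  · exact linEStar_mem_orbitPreserving h2 (by simp)

theorem exists_ETransSp_apply_eq (h2 : IsUnit (2 : R)) {g : (R × R × P) ≃ₗ[R] (R × R × P)}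
    (hg : g ∈ ETrans R (R × P)) {v : R × R × P} (hv : ∃ z, formQ ω.form v z = 1) :
    ∃ k ∈ ETransSp ω, k v = g v := by
  obtain ⟨k, hk, h⟩ := ETrans_le_orbitPreserving h2 hg v hv
  exact ⟨k, relNormalClosure_le hk, h⟩

/-- The conjugate is `z ↦ z + (g⁻¹ z).1 • g (0, x)`. Choosing `k` to agree with the adjoint of `g⁻¹`
on `(0, 1, 0)` gives `(g⁻¹ z).1 = (k⁻¹ z).1`, so it equals `k * linE y.2 * k⁻¹` with `y = k⁻¹ g (0,
x)`. -/
theorem conj_linE_mem_orbitPreserving (h2 : IsUnit (2 : R))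
    {g : (R × R × P) ≃ₗ[R] (R × R × P)} (hg : g ∈ ETrans R (R × P)) {x : R × P}
    (hx : x ∈ (I • ⊤ : Submodule R (R × P))) : g * linE x * g⁻¹ ∈ orbitPreserving ω I := by
  obtain ⟨g', hg', hadj⟩ := exists_adjoint ω g⁻¹ (inv_mem hg)
  obtain ⟨k, hk, hkf⟩ := exists_ETransSp_apply_eq (ω := ω) h2 hg' (v := (0, 1, 0))
    ⟨(-1, 0, 0), by simp⟩
  have hfst (z : R × R × P) : (g⁻¹ (k z)).1 = z.1 := by
    have := hadj (k z) (0, 1, 0)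
    rw [← hkf, formQ_map k hk] at this
    simpa using this
  have hk1 (z : R × R × P) : k (k⁻¹ z) = z := k.apply_symm_apply z
  have hg1 (z : R × R × P) : g⁻¹ (g z) = z := g.symm_apply_apply z
  have hg3 (z : R × R × P) : g (g⁻¹ z) = z := g.apply_symm_apply z
  set y := k⁻¹ (g (0, x)) with hy
  have hy1 : y.1 = 0 := by rw [← hfst, hy, hk1, hg1]
  have hy2 : y.2 ∈ (I • ⊤ : Submodule R (R × P)) :=
    map_mem_smul_top (LinearMap.snd R R (R × P) ∘ₗ (k⁻¹).toLinearMap ∘ₗ g.toLinearMap ∘ₗ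
      LinearMap.inr R R (R × P)) hx
  convert conj_mem_orbitPreserving hk (linE_mem_orbitPreserving h2 hy2) using 1
  refine LinearEquiv.ext fun z => ?_
  have e1 (t : R × R × P) : linE x t = t + t.1 • (0, x) := by ext <;> simp
  have e3 (t : R × R × P) : linE y.2 t = t + t.1 • y := by ext <;> simp [hy1]
  have e4 : (g⁻¹ z).1 = (k⁻¹ z).1 := by rw [← hfst (k⁻¹ z), hk1]
  rw [LinearEquiv.mul_apply, LinearEquiv.mul_apply, LinearEquiv.mul_apply, LinearEquiv.mul_apply,
    e1, e3, map_add, map_add, map_smul, map_smul, hg3, hk1, hy, hk1, e4]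

/-- Dually, the conjugate moves `z` along `g (1, 0, 0) = k (1, 0, 0)`. As `g⁻¹ k` fixes `(1, 0, 0)`,
the transported functional `σ` depends only on the `R × P` component. -/
theorem conj_linEStar_mem_orbitPreserving (h2 : IsUnit (2 : R))
    {g : (R × R × P) ≃ₗ[R] (R × R × P)} (hg : g ∈ ETrans R (R × P)) {τ : Module.Dual R (R × P)}
    (hτ : τ ∈ (I • ⊤ : Submodule R (Module.Dual R (R × P)))) :
    g * linEStar τ * g⁻¹ ∈ orbitPreserving ω I := by
  obtain ⟨k, hk, hke⟩ := exists_ETransSp_apply_eq (ω := ω) h2 hg (v := (1, 0, 0))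
    ⟨(0, 1, 0), by simp⟩
  have hk1 (z : R × R × P) : k (k⁻¹ z) = z := k.apply_symm_apply z
  have hg1 (z : R × R × P) : g⁻¹ (g z) = z := g.symm_apply_apply z
  have hg3 (z : R × R × P) : g (g⁻¹ z) = z := g.apply_symm_apply z
  set σ := (τ ∘ₗ LinearMap.snd R R (R × P)) ∘ₗ (g⁻¹).toLinearMap ∘ₗ k.toLinearMap ∘ₗ
    LinearMap.inr R R (R × P) with hσ
  have hσI : σ ∈ (I • ⊤ : Submodule R (Module.Dual R (R × P))) :=
    map_mem_smul_top (LinearMap.lcomp R R (LinearMap.snd R R (R × P) ∘ₗ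
      (g⁻¹).toLinearMap ∘ₗ k.toLinearMap ∘ₗ LinearMap.inr R R (R × P))) hτ
  convert conj_mem_orbitPreserving hk (linEStar_mem_orbitPreserving h2 hσI) using 1
  refine LinearEquiv.ext fun z => ?_
  have e1 (τ : Module.Dual R (R × P)) (t : R × R × P) :
      linEStar τ t = t + τ t.2 • (1, 0, 0) := by ext <;> simp
  have e3 (t : R × R × P) : σ t.2 = τ (g⁻¹ (k t)).2 := by
    have : t = t.1 • (1, 0, 0) + (0, t.2) := by ext <;> simp
    conv_rhs => rw [this, map_add, map_smul, hke, map_add, map_smul, hg1]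
    simp [hσ, show ((0, 0) : R × P) = 0 from rfl]
  rw [LinearEquiv.mul_apply, LinearEquiv.mul_apply, LinearEquiv.mul_apply, LinearEquiv.mul_apply,
    e1, e1, map_add, map_add, map_smul, map_smul, hg3, hk1, hke, e3, hk1]

theorem ETransRel_le_orbitPreserving (h2 : IsUnit (2 : R)) :
    ETransRel (R × P) I ≤ orbitPreserving ω I := by
  refine relNormalClosure_le_of_conj fun g hg x hx => ?_
  induction hx using Subgroup.closure_induction with
  | mem x hx =>
    rcases hx with ⟨x, hx, rfl⟩ | ⟨τ, hτ, rfl⟩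
    · exact conj_linE_mem_orbitPreserving h2 hg hx
    · exact conj_linEStar_mem_orbitPreserving h2 hg hτ
  | one => simp
  | mul x y _ _ hx hy => simpa [mul_assoc] using mul_mem hx hy
  | inv x _ hx => simpa [mul_assoc] using inv_mem hx

/-- If the values of functionals at `v` all lay in a maximal ideal `m`, projectivity would give `v ∈
mM`, and no functional over `R_m` could take the value `1`. -/
theorem IsUnimodular.exists_dual_eq_one {M : Type*} [AddCommGroup M] [Module R M]
    [Module.Projective R M] {v : M} (hv : IsUnimodular R v) : ∃ φ : Module.Dual R M, φ v = 1 := by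
  by_contra h
  set T : Ideal R := LinearMap.range (LinearMap.applyₗ (R := R) (M₂ := R) v) with hT
  have hT1 : T ≠ ⊤ := fun e => h ((Ideal.eq_top_iff_one T).1 e)
  obtain ⟨m, hm, hTm⟩ := Ideal.exists_le_maximal T hT1
  obtain ⟨w, hw⟩ := hv m
  obtain ⟨s, hs⟩ := Module.projective_def'.1 (inferInstance : Module.Projective R M)
  have hvm : v ∈ (m • ⊤ : Submodule R M) := by
    rw [← LinearMap.id_apply (R := R) v, ← hs, LinearMap.comp_apply,
      Finsupp.linearCombination_apply]
    exact Submodule.sum_mem _ fun i _ =>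
      Submodule.smul_mem_smul (hTm ⟨Finsupp.lapply i ∘ₗ s, rfl⟩) trivial
  have key (x : M) (hx : x ∈ (m • ⊤ : Submodule R M)) :
      w (1 ⊗ₜ[R] x) ∈ IsLocalRing.maximalIdeal (Localization.AtPrime m) := by
    induction hx using Submodule.smul_induction_on' with
    | smul r hr n _ =>
      rw [TensorProduct.tmul_smul, ← algebraMap_smul (Localization.AtPrime m) r, map_smul,
        smul_eq_mul]
      exact Ideal.mul_mem_right _ _
        ((IsLocalization.AtPrime.to_map_mem_maximal_iff (Localization.AtPrime m) m r).2 hr)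
    | add x _ y _ hx hy =>
      rw [TensorProduct.tmul_add, map_add]
      exact add_mem hx hy
  exact (Ideal.ne_top_iff_one _).1 Ideal.IsPrime.ne_top' (hw ▸ key v hvm)

end Comparison

end TransvectionOrbits

theorem mainTheorem1 {R : Type*} [CommRing R] (h2 : IsUnit (2 : R)) (I : Ideal R)
    {P : Type*} [AddCommGroup P] [Module R P] [Module.Finite R P] [Module.Projective R P]
    (n : ℕ) (hn : 1 ≤ n) (hrank : ∀ 𝔭 : PrimeSpectrum R, Module.rankAtStalk P 𝔭 = 2 * n)
    (ω : TransvectionOrbits.SymplecticForm R P)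
    (hω : TransvectionOrbits.LocallyCongruentPsi ω I n)
    (a b : R) (p : P) (hv : (a, b, p) ∈ TransvectionOrbits.UmRel I ((1, 0, 0) : R × R × P)) :
    MulAction.orbit (TransvectionOrbits.ETransRel (R × P) I) (a, b, p) =
      MulAction.orbit (TransvectionOrbits.ETransSpRel ω I) (a, b, p) := by
  obtain ⟨φ, hφ⟩ := hv.1.exists_dual_eq_one
  obtain ⟨z, hz⟩ := TransvectionOrbits.exists_formQ_eq ω φ
  apply Set.Subset.antisymm
  · rintro _ ⟨⟨g, hg⟩, rfl⟩
    obtain ⟨h, hh, e⟩ :=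
      TransvectionOrbits.ETransRel_le_orbitPreserving h2 hg (a, b, p) ⟨z, by rw [hz, hφ]⟩
    exact ⟨⟨h, hh⟩, e⟩
  · rintro _ ⟨⟨h, hh⟩, rfl⟩
    exact ⟨⟨h, TransvectionOrbits.ETransSpRel_le_ETransRel ω I hh⟩, rfl⟩
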